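/- **Setting.** Fix vocabularies $\mathcal V_{\mathsf{Node}}$ and $\mathcal V_{\mathsf{Data}}$ (arbitrary first-order, with relation and function symbols), a non-empty $\mathcal V_{\mathsf{Data}}$-structure $\mathbb D$, a finite set $\Sigma$ of commands, a finite set $\mathbf L$ of locations with designated elements $l_{\mathrm{init}}, l_{\mathrm{err}}$, and maps $\mathsf{src},\mathsf{tgt}:\Sigma\to\mathbf L$. A *topology* is a $\mathcal V_{\mathsf{Node}}$-structure; its elements are called nodes. $N(V)$ denotes the substructure generated by a set (or tuple) $V$ of nodes. Tuples $\vec a,\vec b$ of the same length, over structures with the same vocabulary, are *locally symmetric*, $\vec a\simeq\vec b$, if there is an isomorphism $\beta:N(\vec a)\to N(\vec b)$ with $\beta(\vec a)=\vec b$ (a *local isomorphism*); $\beta^*$ denotes the pullback $\mu\mapsto\mu\circ\beta$ of valuations, and of relations between valuations. **Programs.** A *program* over a topology $\mathbb T$ is a pair $(P,[\![-]\!])$ with $P:\mathbb T\to 2^\Sigma$ and, for each $\langle\sigma:v\rangle\in\Sigma\times\mathbb T$, a relation $[\![\sigma:v]\!]\subseteq (N(v)\to\mathbb D)^2$. For a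 neighbourhood (substructure) $V\supseteq N(v)$, $\mathsf{Global}_V[\![\sigma:v]\!]$ is the set of pairs $(\mu,\mu')\in(V\to\mathbb D)^2$ whose restriction to $N(v)$ is in $[\![\sigma:v]\!]$ and such that $\mu=\mu'$ outside $N(v)$; it extends to words by relation composition. For location maps $\lambda,\lambda':\mathbb T\to\mathbf L$ write $\lambda\xrightarrow{\sigma:v}\lambda'$ if $\sigma\in P(v)$, $\lambda(v)=\mathsf{src}(\sigma)$ and $\lambda'$ is $\lambda$ updated to $\mathsf{tgt}(\sigma)$ at $v$. Write $(\lambda,\mu)\to(\lambda',\mu')$ if, for some $\langle\sigma:v\rangle$, $\lambda\xrightarrow{\sigma:v}\lambda'$ and $(\mu,\mu')\in\mathsf{Global}_{\mathbb T}[\![\sigma:v]\!]$. $\mathcal L_{\mathrm{err}}(P)$ is the set of words over $\Sigma\times\mathbb T$ leading, by steps $\xrightarrow{\sigma:v}$, from the constant map $l_{\mathrm{init}}$ to a location map whose range contains $l_{\mathrm{err}}$. A *parameterized program* over $\{\mathbb T_i\}_{i\in\mathcal I}$ is a family of programs $\{(P_i,[\![-]\!]_i)\}_{i\in\mathcal I}$,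 the $i$-th over $\mathbb T_i$, such that for all $i,j$, $a\in\mathbb T_i$, $a'\in\mathbb T_j$ with $a\simeq a'$ via $\beta$: $P_i(a)=P_j(a')$ and $[\![\sigma:a]\!]_i=\beta^*[\![\sigma:a']\!]_j$ for all $\sigma\in\Sigma$. A *universal structure* for the family is a $\mathcal V_{\mathsf{Node}}$-structure $\mathbb T$ into which each $\mathbb T_i$ embeds; fix such embeddings and identify $\mathbb T_i$ with its image. For $v\in\mathbb T$, $[\![\sigma:v]\!]:=\beta^*[\![\sigma:u]\!]_i$ for any $i$, $u\in\mathbb T_i$ and local isomorphism $\beta$ from $v$ to $u$ (the choice does not matter), and $[\![\sigma:v]\!]:=\varnothing$ if there are none. **Proof spaces.** An *assertion* $\phi[\mu(u_1),\dots,\mu(u_n)]$ is a first-order $\mathcal V_{\mathsf{Data}}$-formula $\phi[x_1,\dots,x_n]$ whose free variables are replaced by the program variables $\mu(u)$ of nodes $u\in\mathbb T$. A *Hoare triple* $\{\phi\}\,\rho\,\{\psi\}$ consists of assertions $\phi,\psi$ and a (possibly empty) word $\rho$ over $\Sigma\times\mathbb T$; it is *valid* if, for $V$ the neighbourhood of all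 nodes appearing in it and all $(\mu,\mu')\in\mathsf{Global}_V[\![\rho]\!]$, $\mu\models\phi$ implies $\mu'\models\psi$. A *$\mathbb T$-proof space* is a set $\mathcal H$ of Hoare triples closed under: - *sequencing*: from $\{\phi_1\}\rho_1\{\phi_2\}$ and $\{\phi_2'\}\rho_2\{\phi_3\}$ infer $\{\phi_1\}\rho_1\rho_2\{\phi_3\}$, provided every conjunct of $\phi_2'$ is (syntactically) a conjunct of $\phi_2$; - *conjunction*: from $\{\phi_1\}\rho\{\psi_1\}$ and $\{\phi_2\}\rho\{\psi_2\}$ infer $\{\phi_1\wedge\phi_2\}\rho\{\psi_1\wedge\psi_2\}$; - *symmetry*: from $\{\phi[\overrightarrow{\mu(u)}]\}\langle\sigma_1:v_1\rangle\cdots\langle\sigma_n:v_n\rangle\{\psi[\overrightarrow{\mu(w)}]\}$ infer $\{\phi[\overrightarrow{\mu(u')}]\}\langle\sigma_1:v_1'\rangle\cdots\langle\sigma_n:v_n'\rangle\{\psi[\overrightarrow{\mu(w')}]\}$, provided $|\vec u|=|\vec u'|$, $|\vec w|=|\vec w'|$ and $\vec u\vec v\vec w\simeq\vec u'\vec v'\vec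 w'$. It is *finitely generated* if it is the smallest $\mathbb T$-proof space containing some finite set of Hoare triples. It *proves the parameterized program safe* if all its triples are valid and $\{\top\}\,\rho\,\{\bot\}\in\mathcal H$ for every $\rho\in\bigcup_{i\in\mathcal I}\mathcal L_{\mathrm{err}}(P_i)$. **Invariants and bases.** An *Ashcroft assertion of width $k\in\mathbb N$* is a sentence $\forall u_1,\dots,u_k.\,\varphi[u_1,\dots,u_k]$, where $u_1,\dots,u_k$ are of sort $\mathsf{Node}$ and $\varphi$ is a first-order formula, with no quantification over $\mathsf{Node}$ and no other free variables, in the three-sorted vocabulary consisting of $\mathcal V_{\mathsf{Node}}$ (sort $\mathsf{Node}$), $\mathcal V_{\mathsf{Data}}$ (sort $\mathsf{Data}$), a constant of sort $\mathsf{Loc}$ for each element of $\mathbf L$, and function symbols $\mu:\mathsf{Node}\to\mathsf{Data}$, $\mathtt l:\mathsf{Node}\to\mathsf{Loc}$. Over a topology it is interpreted in global states $(\lambda,\mu)$. It is a *generalized Ashcroft invariant* of a program if it holds in every $(\lambda,\mu)$ with $\lambda\equiv l_{\mathrm{init}}$, is preserved by $\to$, and implies $\lambda(u)\ne l_{\mathrm{err}}$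 for all nodes $u$; of a parameterized program, if it is one for every member. A *basis of rank $r$* for a family $\mathcal T$ of topologies is a subfamily $\mathcal S$ such that for all $\mathbb T'\in\mathcal T$ and $\vec a\in(\mathbb T')^r$ there are $\mathbb S\in\mathcal S$ and an embedding $f:\mathbb S\hookrightarrow\mathbb T'$ with every component of $\vec a$ in $f(\mathbb S)$. **Theorem.** Let $\mathcal P$ be a parameterized program over a family $\mathcal T=\{\mathbb T_i\}_{i\in\mathcal I}$ of topologies with universal structure $\mathbb T$. If there is a generalized Ashcroft invariant of width $k$ for $\mathcal P$, and $\mathcal T$ has a finite basis of rank $k+1$ consisting of finite topologies, then there is a finitely generated $\mathbb T$-proof space that proves $\mathcal P$ safe. -/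

import Mathlib

namespace ParamProof

open FirstOrder FirstOrder.Language

universe u₁ v₁ u₂ v₂ w₁ w₂ w₃ w₄ w₅ w₆

/-! ### Topologies, neighbourhoods, local symmetry -/

section Topology

variable {LN : FirstOrder.Language.{u₁, v₁}} {M : Type w₁} {M' : Type w₂} [LN.Structure M] [LN.Structure M']

variable (LN) in
/-- The neighbourhood of a node: the substructure it generates. -/
abbrev nbhd (v : M) : LN.Substructure M := Substructure.closure LN {v}

theorem self_mem_nbhd (v : M) : v ∈ nbhd LN v := Substructure.subset_closure rfl

/-- `β` is the local isomorphism from the node `a` to the node `b`. -/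
def IsLocalIso {a : M} {b : M'} (β : nbhd LN a ≃[LN] nbhd LN b) : Prop :=
  (β ⟨a, self_mem_nbhd a⟩ : M') = b

variable (LN) in
/-- Two node tuples `a`, `b` (with the same index type) are locally symmetric if some isomorphism
between the substructures that they generate maps `a` to `b` component-wise. -/
def LocallySymmetric {ι : Type*} (a : ι → M) (b : ι → M') : Prop :=
  ∃ β : Substructure.closure LN (Set.range a) ≃[LN] Substructure.closure LN (Set.range b),
    ∀ i, (β ⟨a i, Substructure.subset_closure ⟨i, rfl⟩⟩ : M') = b i

/-- The pullback of a relation between valuations along `β`, induced by `μ ↦ μ ∘ β`. -/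
def pullback {D : Type w₃} {N : LN.Substructure M} {N' : LN.Substructure M'} (β : N ≃[LN] N')
    (R : Set ((N' → D) × (N' → D))) : Set ((N → D) × (N → D)) :=
  (fun p => (p.1 ∘ β, p.2 ∘ β)) '' R

end Topology

/-- `J` indexes a basis of rank `r` for the family `T` of topologies. -/
def IsTopologyBasis (LN : FirstOrder.Language.{u₁, v₁}) {I : Type w₁} (T : I → Type w₂)
    [∀ i, LN.Structure (T i)] (r : ℕ) (J : Set I) : Prop :=
  ∀ (i : I) (a : Fin r → T i), ∃ j ∈ J, ∃ f : T j ↪[LN] T i, ∀ m, a m ∈ Set.range f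

/-! ### Programs -/

/-- The control-flow data shared by all programs of a family: source and target location of each
command, the initial location, and the error location. -/
structure ControlFlow (C : Type w₄) (Loc : Type w₅) where
  src : C → Loc
  tgt : C → Loc
  init : Loc
  err : Loc

/-- A concurrent program over the topology `M`, with data domain `D` and commands `C`: each node
has a set of commands, and each indexed command has as semantics a binary relation between
valuations of the neighbourhood of its node. -/
structure Program (LN : FirstOrder.Language.{u₁, v₁}) (D : Type w₃) (C : Type w₄) (M : Type w₁)
    [LN.Structure M] where
  code : M → Set C
  sem : C → (v : M) → Set ((nbhd LN v → D) × (nbhd LN v → D))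

section Semantics

variable {LN : FirstOrder.Language.{u₁, v₁}} {M : Type w₁} [LN.Structure M]
  {D : Type w₃} {C : Type w₄} {Loc : Type w₅}

open Classical in
/-- The transition relation between location maps under one indexed command. -/
def LocStep (cf : ControlFlow C Loc) (code : M → Set C) (s : C × M) (l l' : M → Loc) : Prop :=
  s.1 ∈ code s.2 ∧ l s.2 = cf.src s.1 ∧ l' = Function.update l s.2 (cf.tgt s.1)

/-- The transition relation between location maps under a word of indexed commands. -/
def LocRun (cf : ControlFlow C Loc) (code : M → Set C) :
    List (C × M) → (M → Loc) → (M → Loc) → Prop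
  | [], l, l' => l = l'
  | s :: ρ, l, l' => ∃ l₁, LocStep cf code s l l₁ ∧ LocRun cf code ρ l₁ l'

/-- The error runs: words that lead from the constant initial location map to a location map whose
range contains the error location. -/
def errorRuns (cf : ControlFlow C Loc) (code : M → Set C) : Set (List (C × M)) :=
  {ρ | ∃ l', LocRun cf code ρ (fun _ => cf.init) l' ∧ ∃ v, l' v = cf.err}

/-- The semantics of an indexed command on valuations of a neighbourhood `V` that contains the
neighbourhood of its node: nothing outside the latter is accessed. -/
def GlobalStep (sem : C → (v : M) → Set ((nbhd LN v → D) × (nbhd LN v → D)))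
    (V : LN.Substructure M) (s : C × M) (μ μ' : V → D) : Prop :=
  ∃ h : nbhd LN s.2 ≤ V,
    ((fun x => μ ⟨x, h x.2⟩, fun x => μ' ⟨x, h x.2⟩) :
      (nbhd LN s.2 → D) × (nbhd LN s.2 → D)) ∈ sem s.1 s.2 ∧
    ∀ x : V, (x : M) ∉ nbhd LN s.2 → μ x = μ' x

/-- The semantics of a word of indexed commands, by relation composition. -/
def GlobalRun (sem : C → (v : M) → Set ((nbhd LN v → D) × (nbhd LN v → D)))
    (V : LN.Substructure M) : List (C × M) → (V → D) → (V → D) → Prop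
  | [], μ, μ' => μ = μ'
  | s :: ρ, μ, μ' => ∃ μ₁, GlobalStep sem V s μ μ₁ ∧ GlobalRun sem V ρ μ₁ μ'

/-- The transition relation between global states (location map, valuation) of a program. -/
def Program.Step (cf : ControlFlow C Loc) (P : Program LN D C M)
    (g g' : (M → Loc) × (M → D)) : Prop :=
  ∃ s : C × M, LocStep cf P.code s g.1 g'.1 ∧
    GlobalStep P.sem ⊤ s (fun x => g.2 x) (fun x => g'.2 x)

end Semantics

section Family

variable {LN : FirstOrder.Language.{u₁, v₁}} {D : Type w₃} {C : Type w₄} {I : Type w₁} {T : I → Type w₂}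
  [∀ i, LN.Structure (T i)] {U : Type w₆} [LN.Structure U]

/-- A family of programs over common commands, locations, data domain and node vocabulary is a
parameterized program if locally symmetric nodes (of the same or of different members) run the
same code with the same semantics. -/
def IsParameterized (P : ∀ i, Program LN D C (T i)) : Prop :=
  ∀ (i j : I) (a : T i) (b : T j) (β : nbhd LN a ≃[LN] nbhd LN b), IsLocalIso β →
    (P i).code a = (P j).code b ∧ ∀ c, (P i).sem c a = pullback β ((P j).sem c b)

/-- The semantics of indexed commands over a universal structure `U`: if `v` is locally symmetric
to a node `u` of a member of the family, it is the pullback of the semantics at `u` (it does not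
depend on the choice of `u`, see `univSem_eq`); otherwise it is empty. -/
def univSem (P : ∀ i, Program LN D C (T i)) (c : C) (v : U) :
    Set ((nbhd LN v → D) × (nbhd LN v → D)) :=
  {p | ∃ (i : I) (u : T i) (β : nbhd LN v ≃[LN] nbhd LN u),
    IsLocalIso β ∧ p ∈ pullback β ((P i).sem c u)}

theorem univSem_eq {P : ∀ i, Program LN D C (T i)} (hP : IsParameterized P) (c : C) (v : U)
    (i : I) (u : T i) (β : nbhd LN v ≃[LN] nbhd LN u) (hβ : IsLocalIso β) :
    univSem P c v = pullback β ((P i).sem c u) := by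
  apply Set.Subset.antisymm
  · rintro p ⟨j, u', β', hβ', ⟨q, hq, rfl⟩⟩
    have hb : β ⟨v, self_mem_nbhd v⟩ = ⟨u, self_mem_nbhd u⟩ := Subtype.ext hβ
    have hb' : β' ⟨v, self_mem_nbhd v⟩ = ⟨u', self_mem_nbhd u'⟩ := Subtype.ext hβ'
    let γ : nbhd LN u' ≃[LN] nbhd LN u := β.comp β'.symm
    have hγ : IsLocalIso γ := by
      have : β'.symm ⟨u', self_mem_nbhd u'⟩ = ⟨v, self_mem_nbhd v⟩ := by
        rw [← hb', FirstOrder.Language.Equiv.symm_apply_apply]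
      simp [IsLocalIso, γ, Equiv.comp_apply, this, hb]
    rw [(hP j i u' u γ hγ).2 c] at hq
    obtain ⟨r, hr, rfl⟩ := hq
    refine ⟨r, hr, ?_⟩
    ext x <;> simp [γ, Equiv.comp_apply]
  · exact fun p hp => ⟨i, u, β, hβ, hp⟩

end Family

/-! ### Hoare triples and proof spaces -/

section Assertions

variable {LD : FirstOrder.Language.{u₂, v₂}} {U : Type w₆} {D : Type w₃}

open Classical in
/-- An assertion over `U` is a first-order formula in the data vocabulary whose free variables are
the nodes of `U`; the free variable `u` stands for the program variable on the node `u`. This is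
the set of nodes that appear in an assertion. -/
noncomputable def nodes (φ : LD.Formula U) : Set U := ↑(BoundedFormula.freeVarFinset φ)

open Classical in
/-- Truth of an assertion under a valuation of a set `V` of nodes that contains all its nodes. -/
def Sat [LD.Structure D] {V : Set U} (μ : V → D) (φ : LD.Formula U) (h : nodes φ ⊆ V) : Prop :=
  Formula.Realize (BoundedFormula.restrictFreeVar φ (fun x => (⟨x, h x.2⟩ : V))) μ

/-- The set of conjuncts of a formula: conjunctions are taken apart, nothing else is interpreted.
In Mathlib `φ ⊓ ψ` is the formula `(φ.imp (ψ.imp ⊥)).imp ⊥`. -/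
def conjuncts {α : Type*} {n : ℕ} : LD.BoundedFormula α n → Set (LD.BoundedFormula α n)
  | .imp (.imp φ (.imp ψ .falsum)) .falsum => conjuncts φ ∪ conjuncts ψ
  | φ => {φ}

/-- Combinatorial entailment: every conjunct of `ψ` is a conjunct of `φ`. -/
def CombEntails (φ ψ : LD.Formula U) : Prop := conjuncts ψ ⊆ conjuncts φ

end Assertions

/-- A Hoare triple over the structure `U`. -/
structure HoareTriple (LD : FirstOrder.Language.{u₂, v₂}) (C : Type w₄) (U : Type w₆) where
  pre : LD.Formula U
  run : List (C × U)
  post : LD.Formula U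

namespace HoareTriple

variable {LD : FirstOrder.Language.{u₂, v₂}} {C : Type w₄} {U : Type w₆}

/-- All nodes that appear in a Hoare triple. -/
def allNodes (t : HoareTriple LD C U) : Set U :=
  nodes t.pre ∪ {v | ∃ c, (c, v) ∈ t.run} ∪ nodes t.post

/-- The neighbourhood of a Hoare triple. -/
abbrev hood (LN : FirstOrder.Language.{u₁, v₁}) [LN.Structure U] (t : HoareTriple LD C U) :
    LN.Substructure U := Substructure.closure LN t.allNodes

variable {LN : FirstOrder.Language.{u₁, v₁}} [LN.Structure U]

theorem pre_subset (t : HoareTriple LD C U) : nodes t.pre ⊆ (t.hood LN : Set U) :=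
  fun _ hx => Substructure.subset_closure (Or.inl (Or.inl hx))

theorem post_subset (t : HoareTriple LD C U) : nodes t.post ⊆ (t.hood LN : Set U) :=
  fun _ hx => Substructure.subset_closure (Or.inr hx)

/-- Validity of a Hoare triple with respect to a semantics of the indexed commands. -/
def Valid {D : Type w₃} [LD.Structure D]
    (sem : C → (v : U) → Set ((nbhd LN v → D) × (nbhd LN v → D)))
    (t : HoareTriple LD C U) : Prop :=
  ∀ μ μ' : t.hood LN → D, GlobalRun sem (t.hood LN) t.run μ μ' →
    Sat (V := (t.hood LN : Set U)) μ t.pre t.pre_subset →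
    Sat (V := (t.hood LN : Set U)) μ' t.post t.post_subset

end HoareTriple

section ProofSpace

variable (LN : FirstOrder.Language.{u₁, v₁}) {LD : FirstOrder.Language.{u₂, v₂}} {C : Type w₄} {U : Type w₆}
  [LN.Structure U]

/-- A proof space over `U`: a set of Hoare triples closed under sequencing, conjunction, and the
symmetry rule, which renames the nodes of a triple along a local symmetry. -/
structure IsProofSpace (H : Set (HoareTriple LD C U)) : Prop where
  sequencing : ∀ (φ₁ φ₂ φ₂' φ₃ : LD.Formula U) (ρ₁ ρ₂ : List (C × U)),
    ⟨φ₁, ρ₁, φ₂⟩ ∈ H → ⟨φ₂', ρ₂, φ₃⟩ ∈ H → CombEntails φ₂ φ₂' → ⟨φ₁, ρ₁ ++ ρ₂, φ₃⟩ ∈ H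
  conjunction : ∀ (φ₁ φ₂ ψ₁ ψ₂ : LD.Formula U) (ρ : List (C × U)),
    ⟨φ₁, ρ, ψ₁⟩ ∈ H → ⟨φ₂, ρ, ψ₂⟩ ∈ H → ⟨φ₁ ⊓ φ₂, ρ, ψ₁ ⊓ ψ₂⟩ ∈ H
  symmetry : ∀ (p n q : ℕ) (φ : LD.Formula (Fin p)) (c : Fin n → C) (ψ : LD.Formula (Fin q))
    (u u' : Fin p → U) (v v' : Fin n → U) (w w' : Fin q → U),
    LocallySymmetric LN (Sum.elim u (Sum.elim v w)) (Sum.elim u' (Sum.elim v' w')) →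
    ⟨φ.relabel u, List.ofFn fun m => (c m, v m), ψ.relabel w⟩ ∈ H →
    ⟨φ.relabel u', List.ofFn fun m => (c m, v' m), ψ.relabel w'⟩ ∈ H

/-- `H` is the proof space generated by `B`: the smallest proof space containing `B`. -/
def IsGeneratedBy (H B : Set (HoareTriple LD C U)) : Prop :=
  IsLeast {H' | IsProofSpace LN H' ∧ B ⊆ H'} H

/-- `H` is a finitely generated proof space. -/
def IsFinitelyGenerated (H : Set (HoareTriple LD C U)) : Prop :=
  ∃ B : Set (HoareTriple LD C U), B.Finite ∧ IsGeneratedBy LN H B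

/-- The language of a proof space. -/
def language (H : Set (HoareTriple LD C U)) : Set (List (C × U)) := {ρ | ⟨⊤, ρ, ⊥⟩ ∈ H}

variable {LN}

/-- A set `H` of Hoare triples over the universal structure `U` proves a family of programs safe:
all triples of `H` are valid, and every error run of every member, read over `U` through the
embeddings `e`, is in the language of `H`. -/
def ProvesSafe {D : Type w₃} [LD.Structure D] {Loc : Type w₅} {I : Type w₁} {T : I → Type w₂}
    [∀ i, LN.Structure (T i)] (cf : ControlFlow C Loc) (P : ∀ i, Program LN D C (T i))
    (e : ∀ i, T i ↪[LN] U) (H : Set (HoareTriple LD C U)) : Prop :=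
  (∀ t ∈ H, t.Valid (univSem (U := U) P)) ∧
  ∀ i, ∀ ρ ∈ errorRuns cf (P i).code, ρ.map (Prod.map id (e i)) ∈ language H

end ProofSpace

/-! ### Generalized Ashcroft invariants -/

/-- Terms of sort location: a location constant, the location of the node denoted by a node term
(whose variables are among `k` node variables), or one of `p` location variables. -/
inductive LocTerm (LN : FirstOrder.Language.{u₁, v₁}) (Loc : Type w₅) (k p : ℕ) where
  | const : Loc → LocTerm LN Loc k p
  | loc : LN.Term (Fin k) → LocTerm LN Loc k p
  | var : Fin p → LocTerm LN Loc k p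

/-- Three-sorted first-order formulas without quantification over nodes, with free variables among
`k` node variables, `m` data variables and `p` location variables (the latter two kinds are there
to be quantified). A data term is built with the data vocabulary from data variables and from
the values of the program variables at node terms, hence is a
`LD.Term (LN.Term (Fin k) ⊕ Fin m)`. -/
inductive QFAshcroft (LN : FirstOrder.Language.{u₁, v₁}) (LD : FirstOrder.Language.{u₂, v₂}) (Loc : Type w₅) (k : ℕ) :
    ℕ → ℕ → Type (max u₁ v₁ u₂ v₂ w₅) where
  | falsum {m p : ℕ} : QFAshcroft LN LD Loc k m p
  | nodeEq {m p : ℕ} (s t : LN.Term (Fin k)) : QFAshcroft LN LD Loc k m p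
  | nodeRel {m p r : ℕ} (R : LN.Relations r) (t : Fin r → LN.Term (Fin k)) :
      QFAshcroft LN LD Loc k m p
  | dataEq {m p : ℕ} (s t : LD.Term (LN.Term (Fin k) ⊕ Fin m)) : QFAshcroft LN LD Loc k m p
  | dataRel {m p r : ℕ} (R : LD.Relations r) (t : Fin r → LD.Term (LN.Term (Fin k) ⊕ Fin m)) :
      QFAshcroft LN LD Loc k m p
  | locEq {m p : ℕ} (s t : LocTerm LN Loc k p) : QFAshcroft LN LD Loc k m p
  | imp {m p : ℕ} (φ ψ : QFAshcroft LN LD Loc k m p) : QFAshcroft LN LD Loc k m p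
  | allData {m p : ℕ} (φ : QFAshcroft LN LD Loc k (m + 1) p) : QFAshcroft LN LD Loc k m p
  | allLoc {m p : ℕ} (φ : QFAshcroft LN LD Loc k m (p + 1)) : QFAshcroft LN LD Loc k m p

section Ashcroft

variable {LN : FirstOrder.Language.{u₁, v₁}} {LD : FirstOrder.Language.{u₂, v₂}} {M : Type w₁} [LN.Structure M]
  {D : Type w₃} [LD.Structure D] {C : Type w₄} {Loc : Type w₅} {k : ℕ}

/-- The location denoted by a location term. -/
def LocTerm.eval {p : ℕ} (l : M → Loc) (a : Fin k → M) (y : Fin p → Loc) :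
    LocTerm LN Loc k p → Loc
  | .const c => c
  | .loc t => l (t.realize a)
  | .var i => y i

/-- Truth under a location map `l`, a valuation `μ`, and values `a`, `x`, `y` of the variables. -/
def QFAshcroft.Realize (l : M → Loc) (μ : M → D) (a : Fin k → M) : {m p : ℕ} →
    QFAshcroft LN LD Loc k m p → (Fin m → D) → (Fin p → Loc) → Prop
  | _, _, .falsum, _, _ => False
  | _, _, .nodeEq s t, _, _ => s.realize a = t.realize a
  | _, _, .nodeRel R t, _, _ => Structure.RelMap R fun i => (t i).realize a
  | _, _, .dataEq s t, x, _ =>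
      s.realize (Sum.elim (fun b => μ (b.realize a)) x) =
        t.realize (Sum.elim (fun b => μ (b.realize a)) x)
  | _, _, .dataRel R t, x, _ =>
      Structure.RelMap R fun i => (t i).realize (Sum.elim (fun b => μ (b.realize a)) x)
  | _, _, .locEq s t, _, y => s.eval l a y = t.eval l a y
  | _, _, .imp φ ψ, x, y => φ.Realize l μ a x y → ψ.Realize l μ a x y
  | _, _, .allData φ, x, y => ∀ d : D, φ.Realize l μ a (Fin.snoc x d) y
  | _, _, .allLoc φ, x, y => ∀ c : Loc, φ.Realize l μ a x (Fin.snoc y c)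

variable (LN LD Loc k) in
/-- An Ashcroft assertion of width `k`: the sentence `∀ u₁ … u_k, φ`, given by its matrix `φ`,
whose only free variables are the `k` node variables. -/
abbrev Ashcroft := QFAshcroft LN LD Loc k 0 0

/-- The Ashcroft assertion `∀ u₁ … u_k, φ` holds in the global state `g`. -/
def Ashcroft.Holds (φ : Ashcroft LN LD Loc k) (g : (M → Loc) × (M → D)) : Prop :=
  ∀ a : Fin k → M, QFAshcroft.Realize g.1 g.2 a φ Fin.elim0 Fin.elim0

/-- The assertion is an Ashcroft invariant for the program `P`. -/
structure IsAshcroftInvariant (cf : ControlFlow C Loc) (P : Program LN D C M)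
    (φ : Ashcroft LN LD Loc k) : Prop where
  initialization : ∀ g : (M → Loc) × (M → D), (∀ v, g.1 v = cf.init) → Ashcroft.Holds φ g
  continuation : ∀ g g' : (M → Loc) × (M → D),
    Ashcroft.Holds φ g → P.Step cf g g' → Ashcroft.Holds φ g'
  safety : ∀ g : (M → Loc) × (M → D), Ashcroft.Holds φ g → ∀ v, g.1 v ≠ cf.err

end Ashcroft

end ParamProof

/-! A basis topology is finite, so over it an Ashcroft assertion with the locations fixed is a
finite conjunction of data formulas, one per node `k`-tuple. That the assertion is an invariant of a
basis member is then expressed by finitely many valid Hoare triples (`invariantTriples`):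
initialization, one triple per location step and tuple, safety, and trivial ones. Their images in
the universal structure, with one more trivial triple, generate the proof space.

Soundness: the valid triples form a proof space (`isProofSpace_valid`), and a run of commands from a
member, read over the universal structure, restricts to a run over the member, so the images stay
valid (`HoareTriple.Valid.map`).

Completeness is an induction on the run (`insts_mem`): after any run of a member, every finite
conjunction of instances of the invariant is derivable. For an instance at a `k`-tuple after one
more command, the tuple and the active node are `k + 1` nodes, hence lie in an embedded basis
topology. The symmetry rule moves the generator of that topology there (`IsProofSpace.map_mem`), and
its precondition consists of instances at tuples of that topology, available by induction. An error
location sits at some node, hence in an embedded basis topology, where the safety triple yields `⊥`.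

Entailment between assertions is syntactic, so embeddings must carry instances to literally equal
formulas; this is `QFAshcroft.mapFree_resolve`. -/

namespace ParamProof

open FirstOrder FirstOrder.Language

universe u₁ v₁ u₂ v₂ w₁ w₂ w₃ w₄ w₅ w₆

/-! ### Generated substructures and local symmetry. -/

section Closures

variable {LN : FirstOrder.Language.{u₁, v₁}} {M : Type w₁} {M' : Type w₂} [LN.Structure M]
  [LN.Structure M']

/-- An embedding of a generated substructure that maps the generators onto a set `s'` is an
isomorphism onto the substructure generated by `s'`. -/
theorem exists_equiv_closure (s : Set M) (s' : Set M')
    (h : Substructure.closure LN s ↪[LN] M')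
    (h₁ : ∀ x (hx : x ∈ s), h ⟨x, Substructure.subset_closure hx⟩ ∈ s')
    (h₂ : ∀ y ∈ s', ∃ x, ∃ hx : x ∈ s, h ⟨x, Substructure.subset_closure hx⟩ = y) :
    ∃ β : Substructure.closure LN s ≃[LN] Substructure.closure LN s',
      ∀ x, (β x : M') = h x := by
  have hr : h.toHom.range = Substructure.closure LN s' := by
    apply le_antisymm
    · rintro _ ⟨⟨x, hx⟩, rfl⟩
      have key : ∀ x (hx : x ∈ Substructure.closure LN s),
          h ⟨x, hx⟩ ∈ Substructure.closure LN s' := by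
        intro x hx
        refine Substructure.closure_induction' s
          (p := fun x hx => h ⟨x, hx⟩ ∈ Substructure.closure LN s')
          (fun x hx => Substructure.subset_closure (h₁ x hx)) ?_ hx
        intro n f a ha
        choose ha hb using ha
        refine ⟨Substructure.fun_mem _ f _ ha, ?_⟩
        have : (⟨Structure.funMap f a, Substructure.fun_mem _ f _ ha⟩ :
            Substructure.closure LN s) = Structure.funMap f fun i => ⟨a i, ha i⟩ := rfl
        rw [this, h.map_fun]
        exact Substructure.fun_mem _ f _ hb
      exact key x hx
    · rw [Substructure.closure_le]
      intro y hy
      obtain ⟨x, hx, rfl⟩ := h₂ y hy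
      exact ⟨_, rfl⟩
  rw [← hr]
  exact ⟨h.equivRange, fun x => rfl⟩

theorem exists_localIso (v : M) (h : nbhd LN v ↪[LN] M') {v' : M'}
    (hv : h ⟨v, self_mem_nbhd v⟩ = v') :
    ∃ β : nbhd LN v ≃[LN] nbhd LN v', ∀ x, (β x : M') = h x := by
  refine exists_equiv_closure {v} {v'} h ?_ ?_
  · rintro x rfl
    exact hv
  · rintro y rfl
    exact ⟨v, rfl, hv⟩

/-- Both images generate copies of the substructure generated by `s`. This supplies the side
condition of the symmetry rule. -/
theorem locallySymmetric_embeddings {S : Type*} [LN.Structure S] {ι : Type*} (f : S ↪[LN] M)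
    (g : S ↪[LN] M') (s : ι → S) : LocallySymmetric LN (f ∘ s) (g ∘ s) := by
  obtain ⟨β, hβ⟩ := exists_equiv_closure (Set.range s) (Set.range (f ∘ s))
    (f.comp (Substructure.closure LN (Set.range s)).subtype)
    (by rintro _ ⟨i, rfl⟩; exact ⟨i, rfl⟩) (by rintro _ ⟨i, rfl⟩; exact ⟨s i, ⟨i, rfl⟩, rfl⟩)
  obtain ⟨γ, hγ⟩ := exists_equiv_closure (Set.range s) (Set.range (g ∘ s))
    (g.comp (Substructure.closure LN (Set.range s)).subtype)
    (by rintro _ ⟨i, rfl⟩; exact ⟨i, rfl⟩) (by rintro _ ⟨i, rfl⟩; exact ⟨s i, ⟨i, rfl⟩, rfl⟩)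
  refine ⟨γ.comp β.symm, fun i => ?_⟩
  have hb : β ⟨s i, Substructure.subset_closure ⟨i, rfl⟩⟩ =
      ⟨(f ∘ s) i, Substructure.subset_closure ⟨i, rfl⟩⟩ := Subtype.ext (hβ _)
  have hs := Language.Equiv.symm_apply_apply β ⟨s i, Substructure.subset_closure ⟨i, rfl⟩⟩
  rw [hb] at hs
  exact (congrArg (fun x => (γ x : M')) hs).trans (hγ _)

end Closures

/-! ### Restriction and extension of runs between neighbourhoods. -/

section Runs

variable {LN : FirstOrder.Language.{u₁, v₁}} {M : Type w₁} [LN.Structure M]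
  {D : Type w₃} {C : Type w₄}
  {sem : C → (v : M) → Set ((nbhd LN v → D) × (nbhd LN v → D))}

theorem nbhd_le {V : LN.Substructure M} {v : M} (h : v ∈ V) : nbhd LN v ≤ V := by
  rw [Substructure.closure_le]
  rintro _ rfl
  exact h

open Classical in
/-- The extension of a valuation by a constant. -/
noncomputable def extend {V : LN.Substructure M} (d : D) (μ : V → D) (x : M) : D :=
  if h : x ∈ V then μ ⟨x, h⟩ else d

theorem extend_of_mem {V : LN.Substructure M} (d : D) (μ : V → D) {x : M} (h : x ∈ V) :
    extend d μ x = μ ⟨x, h⟩ := dif_pos h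

theorem extend_of_notMem {V : LN.Substructure M} (d : D) (μ : V → D) {x : M} (h : x ∉ V) :
    extend d μ x = d := dif_neg h

variable (sem) in
/-- Runs on valuations of all nodes. -/
abbrev TotalRun (ρ : List (C × M)) (μ μ' : M → D) : Prop :=
  GlobalRun sem ⊤ ρ (fun x => μ x) (fun x => μ' x)

theorem totalRun_cons {s : C × M} {ρ : List (C × M)} {μ μ' : M → D} :
    TotalRun sem (s :: ρ) μ μ' ↔
      ∃ μ₁ : M → D, GlobalStep sem ⊤ s (fun x => μ x) (fun x => μ₁ x) ∧ TotalRun sem ρ μ₁ μ' := by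
  constructor
  · intro h
    obtain ⟨ν, h₁, h₂⟩ : ∃ ν : (⊤ : LN.Substructure M) → D, GlobalStep sem ⊤ s (fun x : (⊤ : LN.Substructure M) => μ x) ν ∧
      GlobalRun sem ⊤ ρ ν (fun x : (⊤ : LN.Substructure M) => μ' x) := h
    exact ⟨fun x => ν ⟨x, trivial⟩, h₁, h₂⟩
  · rintro ⟨ν, h₁, h₂⟩
    exact ⟨_, h₁, h₂⟩

theorem totalRun_nil {μ μ' : M → D} : TotalRun sem [] μ μ' ↔ μ = μ' := by
  constructor
  · intro h
    funext x
    exact congrFun (show (fun x : (⊤ : LN.Substructure M) => μ x) = fun x : (⊤ : LN.Substructure M) => μ' x from h)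
      ⟨x, trivial⟩
  · rintro rfl
    rfl

theorem totalRun_append {ρ₁ ρ₂ : List (C × M)} {μ μ' : M → D} :
    TotalRun sem (ρ₁ ++ ρ₂) μ μ' ↔ ∃ μ₁, TotalRun sem ρ₁ μ μ₁ ∧ TotalRun sem ρ₂ μ₁ μ' := by
  induction ρ₁ generalizing μ with
  | nil => simp [totalRun_nil]
  | cons s ρ ih =>
    rw [List.cons_append, totalRun_cons]
    simp only [totalRun_cons, ih]
    constructor
    · rintro ⟨ν, h₁, ν', h₂, h₃⟩
      exact ⟨ν', ⟨ν, h₁, h₂⟩, h₃⟩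
    · rintro ⟨ν', ⟨ν, h₁, h₂⟩, h₃⟩
      exact ⟨ν, h₁, ν', h₂, h₃⟩

theorem TotalRun.restrict {V : LN.Substructure M} {ρ : List (C × M)} {μ μ' : M → D}
    (hρ : ∀ s ∈ ρ, s.2 ∈ V) (h : TotalRun sem ρ μ μ') :
    GlobalRun sem V ρ (fun x => μ x) (fun x => μ' x) := by
  induction ρ generalizing μ with
  | nil => rw [totalRun_nil.1 h]; rfl
  | cons s ρ ih =>
    obtain ⟨ν, ⟨_, h₁, h₂⟩, h₃⟩ := totalRun_cons.1 h
    exact ⟨fun x => ν x, ⟨nbhd_le (hρ s (by simp)), h₁, fun x hx => h₂ ⟨x, trivial⟩ hx⟩,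
      ih (fun t ht => hρ t (by simp [ht])) h₃⟩

/-- Commands at nodes of `V` access only `V`, so the constant value outside persists through the
run. -/
theorem GlobalRun.extend {V : LN.Substructure M} {ρ : List (C × M)} {μ μ' : V → D} (d : D)
    (h : GlobalRun sem V ρ μ μ') : TotalRun sem ρ (extend d μ) (ParamProof.extend d μ') := by
  induction ρ generalizing μ with
  | nil =>
    rw [show μ = μ' from h]
    exact totalRun_nil.2 rfl
  | cons s ρ ih =>
    obtain ⟨ν, ⟨hV, h₁, h₂⟩, h₃⟩ := h
    refine totalRun_cons.2 ⟨ParamProof.extend d ν, ⟨le_top, ?_, ?_⟩, ih h₃⟩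
    · convert h₁ using 3 with x x
      · exact extend_of_mem _ _ (hV x.2)
      · exact extend_of_mem _ _ (hV x.2)
    · intro x hx
      by_cases hxV : (x : M) ∈ V
      · simpa only [extend_of_mem _ _ hxV] using h₂ ⟨x, hxV⟩ hx
      · simp only [extend_of_notMem _ _ hxV]

end Runs

/-! ### Transport of the semantics along isomorphisms and embeddings. -/

section Transport

variable {LN : FirstOrder.Language.{u₁, v₁}} {D : Type w₃} {C : Type w₄} {I : Type w₁}
  {T : I → Type w₂} [∀ i, LN.Structure (T i)] {U : Type w₆} [LN.Structure U]

theorem pullback_univSem_subset (P : ∀ i, Program LN D C (T i)) (c : C) {v v' : U}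
    (γ : nbhd LN v ≃[LN] nbhd LN v') (hγ : IsLocalIso γ) :
    pullback γ (univSem P c v') ⊆ univSem P c v := by
  rintro _ ⟨q, ⟨i, u, β, hβ, r, hr, rfl⟩, rfl⟩
  refine ⟨i, u, β.comp γ, ?_, r, hr, rfl⟩
  have : γ ⟨v, self_mem_nbhd v⟩ = ⟨v', self_mem_nbhd v'⟩ := Subtype.ext hγ
  simpa [IsLocalIso, Equiv.comp_apply, this] using hβ

/-- `β` restricts to a local isomorphism from `v` onto `v'`; as `β` is injective, nodes outside the
neighbourhood of `v` stay outside that of `v'`, so the frame condition pulls back. -/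
theorem globalStep_comp_equiv (P : ∀ i, Program LN D C (T i)) {V V' : LN.Substructure U}
    (β : V ≃[LN] V') {c : C} {v v' : U} (hv : v ∈ V) (hvv : (β ⟨v, hv⟩ : U) = v') {ν ν' : V' → D}
    (h : GlobalStep (univSem P) V' (c, v') ν ν') :
    GlobalStep (univSem P) V (c, v) (ν ∘ β) (ν' ∘ β) := by
  obtain ⟨hV', h₁, h₂⟩ := h
  have hV := nbhd_le (LN := LN) hv
  obtain ⟨γ, hγ⟩ := exists_localIso v
    ((V'.subtype.comp β.toEmbedding).comp (Substructure.inclusion hV)) hvv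
  have hγ' : ∀ x : nbhd LN v, (⟨γ x, hV' (γ x).2⟩ : V') = β ⟨x, hV x.2⟩ :=
    fun x => Subtype.ext (hγ x)
  refine ⟨hV, pullback_univSem_subset P c γ ((hγ _).trans hvv) ⟨_, h₁, ?_⟩, ?_⟩
  · refine Prod.ext (funext fun x => ?_) (funext fun x => ?_)
    · exact congrArg ν (hγ' x)
    · exact congrArg ν' (hγ' x)
  · intro x hx
    refine h₂ (β x) fun hβx => hx ?_
    obtain ⟨y, hy⟩ := γ.surjective ⟨β x, hβx⟩
    have h₃ : β x = β ⟨y, hV y.2⟩ :=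
      Subtype.ext ((congrArg Subtype.val hy).symm.trans (hγ y))
    rw [β.injective h₃]
    exact y.2

theorem globalRun_comp_equiv (P : ∀ i, Program LN D C (T i)) {V V' : LN.Substructure U}
    (β : V ≃[LN] V') {n : ℕ} (c : Fin n → C) (v v' : Fin n → U) (hv : ∀ m, v m ∈ V)
    (hvv : ∀ m, (β ⟨v m, hv m⟩ : U) = v' m) {ν ν' : V' → D}
    (h : GlobalRun (univSem P) V' (List.ofFn fun m => (c m, v' m)) ν ν') :
    GlobalRun (univSem P) V (List.ofFn fun m => (c m, v m)) (ν ∘ β) (ν' ∘ β) := by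
  induction n generalizing ν with
  | zero =>
    rw [List.ofFn_zero] at h ⊢
    rw [show ν = ν' from h]
    rfl
  | succ n ih =>
    rw [List.ofFn_succ] at h ⊢
    obtain ⟨ν₁, h₁, h₂⟩ := h
    exact ⟨ν₁ ∘ β, globalStep_comp_equiv P β (hv 0) (hvv 0) h₁,
      ih _ _ _ (fun m => hv m.succ) (fun m => hvv m.succ) h₂⟩

/-- Over a universal structure, the image of an indexed command of a member acts on the values at
the member as the command itself. -/
theorem globalStep_comp_embedding {P : ∀ i, Program LN D C (T i)} (hP : IsParameterized P) {i : I}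
    (e : T i ↪[LN] U) {c : C} {v : T i} {μ μ' : U → D}
    (h : GlobalStep (univSem P) ⊤ (c, e v) (fun x => μ x) (fun x => μ' x)) :
    GlobalStep (P i).sem ⊤ (c, v) (fun x => μ (e x)) (fun x => μ' (e x)) := by
  obtain ⟨hV, h₁, h₂⟩ := h
  obtain ⟨γ, hγ⟩ := exists_localIso (v' := e v) v (e.comp (nbhd LN v).subtype) rfl
  have hγv : γ ⟨v, self_mem_nbhd v⟩ = ⟨e v, self_mem_nbhd (e v)⟩ := Subtype.ext (hγ _)
  have hloc : IsLocalIso γ.symm := by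
    have hs := Language.Equiv.symm_apply_apply γ ⟨v, self_mem_nbhd v⟩
    rw [hγv] at hs
    exact congrArg Subtype.val hs
  -- The semantics does not depend on the chosen representative, so `v` itself may represent `e v`.
  rw [univSem_eq hP c (e v) i v γ.symm hloc] at h₁
  obtain ⟨⟨r, r'⟩, hr, hrr⟩ := h₁
  have h₃ : ∀ x : nbhd LN v, r x = μ (e x) := fun x => by
    have h₄ := congrFun (congrArg Prod.fst hrr) (γ x)
    have h₅ := congrArg r (Language.Equiv.symm_apply_apply γ x)
    exact h₅.symm.trans (h₄.trans (congrArg μ (hγ x)))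
  have h₃' : ∀ x : nbhd LN v, r' x = μ' (e x) := fun x => by
    have h₄ := congrFun (congrArg Prod.snd hrr) (γ x)
    have h₅ := congrArg r' (Language.Equiv.symm_apply_apply γ x)
    exact h₅.symm.trans (h₄.trans (congrArg μ' (hγ x)))
  refine ⟨le_top, ?_, ?_⟩
  · rw [funext h₃, funext h₃'] at hr
    exact hr
  · intro x hx
    refine h₂ ⟨e x, trivial⟩ fun hex => hx ?_
    obtain ⟨y, hy⟩ := γ.surjective ⟨e x, hex⟩
    have h₅ : e y = e x := (hγ y).symm.trans (congrArg Subtype.val hy)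
    rw [← e.injective h₅]
    exact y.2

theorem code_embedding {P : ∀ i, Program LN D C (T i)} (hP : IsParameterized P) {i j : I}
    (f : T j ↪[LN] T i) (v : T j) : (P j).code v = (P i).code (f v) := by
  obtain ⟨γ, hγ⟩ := exists_localIso (v' := f v) v (f.comp (nbhd LN v).subtype) rfl
  exact (hP j i v (f v) γ (hγ _)).1

/-- Code is invariant under local symmetry, and injectivity of `f` makes the update at `f v` an
update at `v` alone. -/
theorem locStep_comp_embedding {Loc : Type w₅} {cf : ControlFlow C Loc}
    {P : ∀ i, Program LN D C (T i)} (hP : IsParameterized P) {i j : I} (f : T j ↪[LN] T i) {c : C}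
    {v : T j} {l l' : T i → Loc} (h : LocStep cf (P i).code (c, f v) l l') :
    LocStep cf (P j).code (c, v) (l ∘ f) (l' ∘ f) := by
  obtain ⟨h₁, h₂, h₃⟩ := h
  classical
  refine ⟨by rw [code_embedding hP f]; exact h₁, h₂, ?_⟩
  rw [h₃]
  funext x
  by_cases hx : x = v
  · subst hx
    simp
  · simp [Function.update_of_ne, hx, f.injective.ne hx]

end Transport

/-! ### Soundness of the rules of proof spaces. -/

section Soundness

variable {LN : FirstOrder.Language.{u₁, v₁}} {LD : FirstOrder.Language.{u₂, v₂}} {D : Type w₃}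
  [LD.Structure D] {C : Type w₄} {I : Type w₁}
  {T : I → Type w₂} [∀ i, LN.Structure (T i)] {U : Type w₆} [LN.Structure U]

theorem sat_iff_realize {V : Set U} {μ : V → D} {φ : LD.Formula U} (h : nodes φ ⊆ V) {ν : U → D}
    (hν : ∀ x : V, ν x = μ x) : Sat μ φ h ↔ φ.Realize ν := by
  classical
  exact BoundedFormula.realize_restrictFreeVar ν fun a => (hν _).symm

/-- Total runs restrict to the neighbourhood of the triple, and local runs extend by a constant,
which requires a data value. All triples can thus be compared on valuations of the whole structure.
-/
theorem HoareTriple.valid_iff [Nonempty D]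
    {sem : C → (v : U) → Set ((nbhd LN v → D) × (nbhd LN v → D))} {t : HoareTriple LD C U} :
    t.Valid sem ↔ ∀ μ μ' : U → D, TotalRun sem t.run μ μ' → t.pre.Realize μ → t.post.Realize μ' := by
  constructor
  · intro h μ μ' hr hp
    refine (sat_iff_realize t.post_subset fun _ => rfl).1 (h (fun x => μ x) (fun x => μ' x)
      (hr.restrict fun s hs => Substructure.subset_closure (Or.inl (Or.inr ⟨s.1, hs⟩)))
      ((sat_iff_realize t.pre_subset fun _ => rfl).2 hp))
  · intro h μ μ' hr hp
    obtain ⟨d⟩ := ‹Nonempty D›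
    exact (sat_iff_realize t.post_subset fun x => extend_of_mem d μ' x.2).2
      (h _ _ (hr.extend d)
        ((sat_iff_realize t.pre_subset fun x => extend_of_mem d μ x.2).1 hp))

theorem conjuncts_inf {α : Type*} {n : ℕ} (φ ψ : LD.BoundedFormula α n) :
    conjuncts (φ ⊓ ψ) = conjuncts φ ∪ conjuncts ψ := rfl

/-- This makes sequencing sound: inclusion of conjuncts implies semantic entailment. -/
theorem realize_iff_conjuncts {α : Type*} {n : ℕ} (φ : LD.BoundedFormula α n) {v : α → D}
    {xs : Fin n → D} : φ.Realize v xs ↔ ∀ χ ∈ conjuncts φ, χ.Realize v xs := by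
  fun_induction conjuncts φ with
  | case1 n φ ψ ih₁ ih₂ =>
    have : ((φ.imp (ψ.imp .falsum)).imp .falsum) = φ ⊓ ψ := rfl
    rw [this, BoundedFormula.realize_inf, ih₁, ih₂]
    simp only [Set.mem_union, or_imp, forall_and]
  | case2 n φ h => simp

/-- The valid triples form a proof space. -/
theorem isProofSpace_valid [Nonempty D] (P : ∀ i, Program LN D C (T i)) :
    IsProofSpace LN {t : HoareTriple LD C U | t.Valid (univSem P)} where
  sequencing φ₁ φ₂ φ₂' φ₃ ρ₁ ρ₂ h₁ h₂ hc := by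
    rw [Set.mem_ofPred_eq, HoareTriple.valid_iff] at *
    intro μ μ' hr hp
    obtain ⟨ν, hr₁, hr₂⟩ := totalRun_append.1 hr
    refine h₂ ν μ' hr₂ ((realize_iff_conjuncts _).2 fun χ hχ => ?_)
    exact (realize_iff_conjuncts _).1 (h₁ μ ν hr₁ hp) χ (hc hχ)
  conjunction φ₁ φ₂ ψ₁ ψ₂ ρ h₁ h₂ := by
    rw [Set.mem_ofPred_eq, HoareTriple.valid_iff] at *
    intro μ μ' hr hp
    have hp := BoundedFormula.realize_inf.1 hp
    exact BoundedFormula.realize_inf.2 ⟨h₁ μ μ' hr hp.1, h₂ μ μ' hr hp.2⟩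
  symmetry p n q φ c ψ u u' v v' w w' := by
    rintro ⟨β, hβ⟩ h
    rw [Set.mem_ofPred_eq, HoareTriple.valid_iff] at *
    intro μ μ' hr hp
    obtain ⟨d⟩ := ‹Nonempty D›
    have hmem : ∀ i, Sum.elim u (Sum.elim v w) i ∈
        Substructure.closure LN (Set.range (Sum.elim u (Sum.elim v w))) :=
      fun i => Substructure.subset_closure ⟨i, rfl⟩
    have hmem' : ∀ i, Sum.elim u' (Sum.elim v' w') i ∈
        Substructure.closure LN (Set.range (Sum.elim u' (Sum.elim v' w'))) :=
      fun i => Substructure.subset_closure ⟨i, rfl⟩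
    -- The run is restricted to the neighbourhood of the renamed tuple, pulled back along `β`, and
    -- extended by `d`, so that the given triple applies.
    have hrV := hr.restrict (V := Substructure.closure LN
      (Set.range (Sum.elim u' (Sum.elim v' w')))) (by
        intro s hs
        obtain ⟨m, rfl⟩ := (List.mem_ofFn' _ _).1 hs
        exact hmem' (.inr (.inl m)))
    have hrU := (globalRun_comp_equiv P β c v v' (fun m => hmem (.inr (.inl m)))
      (fun m => hβ (.inr (.inl m))) hrV).extend d
    have hval : ∀ (ν : U → D) i, extend d ((fun x : Substructure.closure LN
        (Set.range (Sum.elim u' (Sum.elim v' w'))) => ν x) ∘ β) (Sum.elim u (Sum.elim v w) i) =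
          ν (Sum.elim u' (Sum.elim v' w') i) := by
      intro ν i
      rw [extend_of_mem d _ (hmem i)]
      exact congrArg ν (hβ i)
    have key := h _ _ hrU
    simp only [Formula.realize_relabel] at key hp ⊢
    have hu : ∀ ν : U → D, extend d ((fun x : Substructure.closure LN
        (Set.range (Sum.elim u' (Sum.elim v' w'))) => ν x) ∘ β) ∘ u = ν ∘ u' :=
      fun ν => funext fun m => hval ν (.inl m)
    have hw : ∀ ν : U → D, extend d ((fun x : Substructure.closure LN
        (Set.range (Sum.elim u' (Sum.elim v' w'))) => ν x) ∘ β) ∘ w = ν ∘ w' :=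
      fun ν => funext fun m => hval ν (.inr (.inr m))
    rw [hu, hw] at key
    exact key hp

end Soundness

/-! ### Functoriality of renaming, as equality of formulas. -/

section Renaming

variable {LD : FirstOrder.Language.{u₂, v₂}} {D : Type w₃} [LD.Structure D] {α β γ : Type*}

/-- Renaming of the free variables of a formula. -/
def mapFree (f : α → β) {n : ℕ} (φ : LD.BoundedFormula α n) : LD.BoundedFormula β n :=
  φ.mapTermRel (fun _ t => t.relabel (Sum.map f id)) (fun _ => id) fun _ => id

theorem relabelAux_inl_comp (f : α → β) (n : ℕ) :
    BoundedFormula.relabelAux (Sum.inl ∘ f : α → β ⊕ Fin 0) n =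
      Sum.map id (Fin.castLE (zero_add n).ge) ∘ Sum.map f id := by
  funext x
  rcases x with x | x
  · simp [BoundedFormula.relabelAux]
  · simp [BoundedFormula.relabelAux, Fin.ext_iff]

/-- `relabel` takes `n` bound variables to `0 + n`; up to this cast it is `mapFree`, whose
functoriality is a computation on terms. -/
theorem boundedFormula_relabel_eq (f : α → β) {n : ℕ} (φ : LD.BoundedFormula α n) :
    φ.relabel (Sum.inl ∘ f : α → β ⊕ Fin 0) = (mapFree f φ).castLE (zero_add n).ge := by
  induction φ with
  | falsum => rfl
  | equal t₁ t₂ =>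
    simp only [BoundedFormula.relabel, mapFree, BoundedFormula.mapTermRel, BoundedFormula.castLE,
      relabelAux_inl_comp, Term.relabel_relabel]
  | rel R ts =>
    simp only [BoundedFormula.relabel, mapFree, BoundedFormula.mapTermRel, BoundedFormula.castLE,
      relabelAux_inl_comp]
    congr 1
    funext i
    simp
  | imp φ ψ ih₁ ih₂ =>
    rw [BoundedFormula.relabel_imp, ih₁, ih₂]
    rfl
  | all φ ih =>
    rw [BoundedFormula.relabel_all, ih]
    rfl

theorem relabel_eq_mapFree (f : α → β) (φ : LD.Formula α) : φ.relabel f = mapFree f φ :=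
  (boundedFormula_relabel_eq f φ).trans (BoundedFormula.castLE_rfl _ _)

theorem mapFree_mapFree (f : α → β) (g : β → γ) {n : ℕ} (φ : LD.BoundedFormula α n) :
    mapFree g (mapFree f φ) = mapFree (g ∘ f) φ := by
  rw [mapFree, mapFree, mapFree, BoundedFormula.mapTermRel_mapTermRel]
  congr 1
  funext n t
  simp [Sum.map_comp_map]

theorem relabel_relabel (f : α → β) (g : β → γ) (φ : LD.Formula α) :
    (φ.relabel f).relabel g = φ.relabel (g ∘ f) := by
  rw [relabel_eq_mapFree, relabel_eq_mapFree, relabel_eq_mapFree, mapFree_mapFree]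

/-- The conjunction of a list of formulas. -/
def conj {n : ℕ} (X : List (LD.BoundedFormula α n)) : LD.BoundedFormula α n :=
  X.foldr (· ⊓ ·) ⊤

theorem mapFree_conj (f : α → β) {n : ℕ} (X : List (LD.BoundedFormula α n)) :
    mapFree f (conj X) = conj (X.map (mapFree f)) := by
  induction X with
  | nil => rfl
  | cons φ X ih =>
    rw [List.map_cons, conj, List.foldr_cons, conj, List.foldr_cons, ← conj, ← conj, ← ih]
    rfl

theorem realize_conj {n : ℕ} (X : List (LD.BoundedFormula α n)) {v : α → D} {xs : Fin n → D} :
    (conj X).Realize v xs ↔ ∀ φ ∈ X, φ.Realize v xs := by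
  simp [conj]

end Renaming

/-! ### Instances of an Ashcroft assertion as data formulas. -/

section Resolution

variable {LN : FirstOrder.Language.{u₁, v₁}} {LD : FirstOrder.Language.{u₂, v₂}} {M : Type w₁}
  [LN.Structure M] {S : Type w₂} [LN.Structure S] {D : Type w₃} [LD.Structure D] {Loc : Type w₅}
  {k : ℕ}

open Classical in
/-- The data formula that remains of the matrix of an Ashcroft assertion over a topology `M` when
the locations and the values of the node variables are given: the node and location atoms are
replaced by their truth values, and quantification over locations by conjunction. -/
noncomputable def QFAshcroft.resolve (L : List Loc) (l : M → Loc) (a : Fin k → M) : {m p : ℕ} →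
    QFAshcroft LN LD Loc k m p → (Fin p → Loc) → LD.BoundedFormula M m
  | _, _, .falsum, _ => ⊥
  | _, _, .nodeEq s t, _ => if s.realize a = t.realize a then ⊤ else ⊥
  | _, _, .nodeRel R t, _ => if Structure.RelMap R fun i => (t i).realize a then ⊤ else ⊥
  | _, _, .dataEq s t, _ =>
      .equal (s.relabel (Sum.map (fun b => b.realize a) id))
        (t.relabel (Sum.map (fun b => b.realize a) id))
  | _, _, .dataRel R t, _ => .rel R fun i => (t i).relabel (Sum.map (fun b => b.realize a) id)
  | _, _, .locEq s t, y => if s.eval l a y = t.eval l a y then ⊤ else ⊥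
  | _, _, .imp φ ψ, y => (φ.resolve L l a y).imp (ψ.resolve L l a y)
  | _, _, .allData φ, y => (φ.resolve L l a y).all
  | _, _, .allLoc φ, y => conj (L.map fun c => φ.resolve L l a (Fin.snoc y c))

theorem QFAshcroft.realize_resolve {L : List Loc} (hL : ∀ c, c ∈ L) (l : M → Loc) (a : Fin k → M)
    {m p : ℕ} (φ : QFAshcroft LN LD Loc k m p) (μ : M → D) (x : Fin m → D) (y : Fin p → Loc) :
    (φ.resolve L l a y).Realize μ x ↔ φ.Realize l μ a x y := by
  induction φ with
  | falsum => rfl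
  | nodeEq s t =>
    simp only [resolve, Realize]
    split_ifs with h <;> simp [h]
  | nodeRel R t =>
    simp only [resolve, Realize]
    split_ifs with h <;> simp [h]
  | dataEq s t =>
    simp only [resolve, Realize, BoundedFormula.Realize, Term.realize_relabel, Sum.elim_comp_map]
    rfl
  | dataRel R t =>
    simp only [resolve, Realize, BoundedFormula.Realize, Term.realize_relabel, Sum.elim_comp_map]
    rfl
  | locEq s t =>
    simp only [resolve, Realize]
    split_ifs with h <;> simp [h]
  | imp φ ψ ih₁ ih₂ => simp only [resolve, Realize, BoundedFormula.realize_imp, ih₁, ih₂]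
  | allData φ ih => simp only [resolve, Realize, BoundedFormula.realize_all, ih]
  | allLoc φ ih => simp [resolve, Realize, realize_conj, ih, hL]

theorem LocTerm.eval_comp_embedding (f : S ↪[LN] M) (l : M → Loc) (a : Fin k → S) {p : ℕ}
    (y : Fin p → Loc) (t : LocTerm LN Loc k p) :
    t.eval (l ∘ f) a y = t.eval l (f ∘ a) y := by
  cases t with
  | const c => rfl
  | loc t => simp [eval, HomClass.realize_term]
  | var i => rfl

/-- Embeddings commute with node terms and preserve and reflect equality and relations, so each node
or location atom resolves to the same truth value on both sides. The common list `L` fixes the order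
of the conjunctions. -/
theorem QFAshcroft.mapFree_resolve (f : S ↪[LN] M) (L : List Loc) (l : M → Loc) (a : Fin k → S)
    {m p : ℕ} (φ : QFAshcroft LN LD Loc k m p) (y : Fin p → Loc) :
    mapFree f (φ.resolve L (l ∘ f) a y) = φ.resolve L l (f ∘ a) y := by
  classical
  have ht : ∀ t : LN.Term (Fin k), t.realize (f ∘ a) = f (t.realize a) :=
    fun t => HomClass.realize_term f
  have hdata : ∀ {n : ℕ} (t : LD.Term (LN.Term (Fin k) ⊕ Fin n)),
      (t.relabel (Sum.map (fun b => b.realize a) id)).relabel (Sum.map f id) =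
        t.relabel (Sum.map (fun b => b.realize (f ∘ a)) id) := by
    intro n t
    rw [Term.relabel_relabel, Sum.map_comp_map, funext ht]
    rfl
  have hite : ∀ {n : ℕ} {p q : Prop} [Decidable p] [Decidable q], (p ↔ q) →
      mapFree f (if p then ⊤ else ⊥ : LD.BoundedFormula S n) = if q then ⊤ else ⊥ := by
    intro n p q _ _ h
    by_cases hp : p
    · rw [if_pos hp, if_pos (h.1 hp)]; rfl
    · rw [if_neg hp, if_neg (mt h.2 hp)]; rfl
  induction φ with
  | falsum => rfl
  | nodeEq s t => exact hite (by rw [ht, ht, f.injective.eq_iff])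
  | nodeRel R t =>
    refine hite ?_
    rw [funext fun i => ht (t i)]
    exact (f.map_rel R _).symm
  | dataEq s t => exact congrArg₂ BoundedFormula.equal (hdata s) (hdata t)
  | dataRel R t => exact congrArg (BoundedFormula.rel R) (funext fun i => hdata (t i))
  | locEq s t => exact hite (by rw [LocTerm.eval_comp_embedding, LocTerm.eval_comp_embedding])
  | imp φ ψ ih₁ ih₂ =>
    rw [resolve, resolve, ← ih₁, ← ih₂]
    rfl
  | allData φ ih =>
    rw [resolve, resolve, ← ih]
    rfl
  | allLoc φ ih =>
    rw [resolve, resolve, mapFree_conj, List.map_map]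
    exact congrArg conj (List.map_congr_left fun c _ => ih _)

/-- The instance of an Ashcroft assertion at a node tuple, for given locations. -/
noncomputable def Ashcroft.inst (φ : Ashcroft LN LD Loc k) (L : List Loc) (l : M → Loc)
    (a : Fin k → M) : LD.Formula M :=
  QFAshcroft.resolve L l a φ Fin.elim0

/-- The conjunction of the instances of an Ashcroft assertion at the node tuples of a list. -/
noncomputable def Ashcroft.insts (φ : Ashcroft LN LD Loc k) (L : List Loc) (l : M → Loc)
    (A : List (Fin k → M)) : LD.Formula M :=
  conj (A.map (φ.inst L l))

theorem Ashcroft.relabel_inst (f : S ↪[LN] M) (φ : Ashcroft LN LD Loc k) (L : List Loc)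
    (l : M → Loc) (a : Fin k → S) :
    (φ.inst L (l ∘ f) a).relabel f = φ.inst L l (f ∘ a) := by
  rw [relabel_eq_mapFree]
  exact QFAshcroft.mapFree_resolve f L l a φ _

theorem Ashcroft.relabel_insts (f : S ↪[LN] M) (φ : Ashcroft LN LD Loc k) (L : List Loc)
    (l : M → Loc) (A : List (Fin k → S)) :
    (φ.insts L (l ∘ f) A).relabel f = φ.insts L l (A.map (f ∘ ·)) := by
  rw [relabel_eq_mapFree, insts, insts, mapFree_conj, List.map_map, List.map_map]
  refine congrArg conj (List.map_congr_left fun a _ => ?_)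
  exact QFAshcroft.mapFree_resolve f L l a φ _

theorem Ashcroft.realize_inst {L : List Loc} (hL : ∀ c, c ∈ L) (φ : Ashcroft LN LD Loc k)
    (l : M → Loc) (a : Fin k → M) (μ : M → D) :
    (φ.inst L l a).Realize μ ↔ QFAshcroft.Realize l μ a φ Fin.elim0 Fin.elim0 := by
  rw [← QFAshcroft.realize_resolve hL, inst, Formula.Realize,
    Subsingleton.elim (default : Fin 0 → D) Fin.elim0]

theorem Ashcroft.holds_of_realize_insts {L : List Loc} (hL : ∀ c, c ∈ L)
    {φ : Ashcroft LN LD Loc k} {l : M → Loc} {A : List (Fin k → M)} (hA : ∀ a, a ∈ A) {μ : M → D}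
    (h : (φ.insts L l A).Realize μ) : φ.Holds (l, μ) := by
  intro a
  rw [← realize_inst hL]
  exact (realize_conj _).1 h _ (List.mem_map_of_mem (hA a))

end Resolution

/-! ### Generated proof spaces and derived rules. -/

section Generation

variable (LN : FirstOrder.Language.{u₁, v₁}) {LD : FirstOrder.Language.{u₂, v₂}} {C : Type w₄}
  {U : Type w₆} [LN.Structure U]

/-- Every set of triples generates a proof space. -/
theorem exists_isGeneratedBy (B : Set (HoareTriple LD C U)) : ∃ H, IsGeneratedBy LN H B := by
  refine ⟨⋂₀ {H' | IsProofSpace LN H' ∧ B ⊆ H'}, ⟨⟨?_, ?_, ?_⟩, ?_⟩, ?_⟩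
  · intro φ₁ φ₂ φ₂' φ₃ ρ₁ ρ₂ h₁ h₂ hc H' hH'
    exact hH'.1.sequencing φ₁ φ₂ φ₂' φ₃ ρ₁ ρ₂ (h₁ H' hH') (h₂ H' hH') hc
  · intro φ₁ φ₂ ψ₁ ψ₂ ρ h₁ h₂ H' hH'
    exact hH'.1.conjunction φ₁ φ₂ ψ₁ ψ₂ ρ (h₁ H' hH') (h₂ H' hH')
  · intro p n q φ c ψ u u' v v' w w' hs h H' hH'
    exact hH'.1.symmetry p n q φ c ψ u u' v v' w w' hs (h H' hH')
  · exact fun t ht H' hH' => hH'.2 ht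
  · exact fun H' hH' => Set.sInter_subset_of_mem hH'

variable {LN}

/-- The conjunction rule turns the precondition into `⊤ ⊓ ⊤`; sequencing after `hnil` restores `⊤`,
the conjuncts being the same. The empty conjunction is `htop`. -/
theorem IsProofSpace.conj_mem {H : Set (HoareTriple LD C U)} (hH : IsProofSpace LN H)
    (hnil : ⟨⊤, [], ⊤⟩ ∈ H) {ρ : List (C × U)} (htop : ⟨⊤, ρ, ⊤⟩ ∈ H)
    (X : List (LD.Formula U)) (hX : ∀ φ ∈ X, ⟨⊤, ρ, φ⟩ ∈ H) : ⟨⊤, ρ, conj X⟩ ∈ H := by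
  induction X with
  | nil => exact htop
  | cons φ X ih =>
    have h₁ := hH.conjunction _ _ _ _ ρ (hX φ (by simp)) (ih fun ψ hψ => hX ψ (by simp [hψ]))
    refine hH.sequencing ⊤ ⊤ (⊤ ⊓ ⊤) _ [] ρ hnil h₁ ?_
    rw [CombEntails, conjuncts_inf, Set.union_self]

/-- The image of a triple over a topology under a map of nodes. -/
def HoareTriple.map {S : Type*} (f : S → U) (t : HoareTriple LD C S) : HoareTriple LD C U :=
  ⟨t.pre.relabel f, t.run.map (Prod.map id f), t.post.relabel f⟩

/-- The images of a triple under two embeddings of a finite topology are interderivable. -/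
theorem IsProofSpace.map_mem {H : Set (HoareTriple LD C U)} (hH : IsProofSpace LN H)
    {S : Type*} [LN.Structure S] [Finite S] (f g : S ↪[LN] U) {t : HoareTriple LD C S}
    (ht : t.map f ∈ H) : t.map g ∈ H := by
  -- The symmetry rule speaks of formulas over finite tuples; an enumeration of all of `S` serves
  -- both pre- and postcondition.
  obtain ⟨N, ⟨E⟩⟩ := Finite.exists_equiv_fin S
  have hrun : ∀ h : S → U, (List.ofFn fun m : Fin t.run.length =>
      ((t.run.get m).1, h (t.run.get m).2)) = t.run.map (Prod.map id h) := by
    intro h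
    conv_rhs => rw [← List.ofFn_get t.run, List.map_ofFn]
    rfl
  have hrel : ∀ (h : S → U) (φ : LD.Formula S), (φ.relabel E).relabel (h ∘ E.symm) = φ.relabel h := by
    intro h φ
    rw [relabel_relabel]
    congr 1
    funext x
    simp
  have key := hH.symmetry N t.run.length N (t.pre.relabel E) (fun m => (t.run.get m).1)
    (t.post.relabel E) (f ∘ E.symm) (g ∘ E.symm) (fun m => f (t.run.get m).2)
    (fun m => g (t.run.get m).2) (f ∘ E.symm) (g ∘ E.symm) ?_ ?_
  · rw [hrel, hrel, hrun] at key
    exact key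
  · have h := locallySymmetric_embeddings f g
      (Sum.elim E.symm (Sum.elim (fun m : Fin t.run.length => (t.run.get m).2) E.symm))
    rw [Sum.comp_elim, Sum.comp_elim, Sum.comp_elim, Sum.comp_elim] at h
    exact h
  · rw [hrel, hrel, hrun]
    exact ht

end Generation

/-! ### Runs of members inside the universal structure. -/

section Runs

variable {LN : FirstOrder.Language.{u₁, v₁}} {LD : FirstOrder.Language.{u₂, v₂}} {D : Type w₃}
  [LD.Structure D] {C : Type w₄} {Loc : Type w₅} {I : Type w₁}
  {T : I → Type w₂} [∀ i, LN.Structure (T i)] {U : Type w₆} [LN.Structure U]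

theorem totalRun_comp_embedding {P : ∀ i, Program LN D C (T i)} (hP : IsParameterized P) {i : I}
    (e : T i ↪[LN] U) {ρ : List (C × T i)} {μ μ' : U → D}
    (h : TotalRun (univSem P) (ρ.map (Prod.map id e)) μ μ') :
    TotalRun (P i).sem ρ (μ ∘ e) (μ' ∘ e) := by
  induction ρ generalizing μ with
  | nil => rw [totalRun_nil.1 h]; rfl
  | cons s ρ ih =>
    obtain ⟨ν, h₁, h₂⟩ := totalRun_cons.1 h
    exact totalRun_cons.2 ⟨ν ∘ e, globalStep_comp_embedding hP e h₁, ih h₂⟩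

/-- Triples that are valid over a member are valid over the universal structure. -/
theorem HoareTriple.Valid.map [Nonempty D] {P : ∀ i, Program LN D C (T i)}
    (hP : IsParameterized P) {i : I} (e : T i ↪[LN] U) {t : HoareTriple LD C (T i)}
    (ht : t.Valid (P i).sem) : (t.map e).Valid (univSem (U := U) P) := by
  rw [HoareTriple.valid_iff] at ht ⊢
  intro μ μ' hr hp
  exact Formula.realize_relabel.2
    (ht _ _ (totalRun_comp_embedding hP e hr) (Formula.realize_relabel.1 hp))

/-- `LocRun` recurses on the first command, whereas `insts_mem` inducts on the last. -/
theorem locRun_append_singleton {M : Type*} {cf : ControlFlow C Loc} {code : M → Set C}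
    {ρ : List (C × M)} {s : C × M} {l l' : M → Loc} (h : LocRun cf code (ρ ++ [s]) l l') :
    ∃ l₁, LocRun cf code ρ l l₁ ∧ LocStep cf code s l₁ l' := by
  induction ρ generalizing l with
  | nil =>
    obtain ⟨l₁, h₁, rfl⟩ := h
    exact ⟨l, rfl, h₁⟩
  | cons t ρ ih =>
    obtain ⟨l₁, h₁, h₂⟩ := h
    obtain ⟨l₂, h₃, h₄⟩ := ih h₂
    exact ⟨l₂, ⟨l₁, h₁, h₃⟩, h₄⟩

end Runs

/-! ### The finitely many generating triples and their validity. -/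

section Generators

variable {LN : FirstOrder.Language.{u₁, v₁}} {LD : FirstOrder.Language.{u₂, v₂}} {D : Type w₃}
  {C : Type w₄} {Loc : Type w₅} {S : Type w₁} [LN.Structure S] {k : ℕ}

/-- The triples over a topology that express that an Ashcroft assertion is an invariant: `A` lists
the node tuples at which the assertion is assumed. -/
def invariantTriples (cf : ControlFlow C Loc) (P : Program LN D C S) (φ : Ashcroft LN LD Loc k)
    (L : List Loc) (A : List (Fin k → S)) : Set (HoareTriple LD C S) :=
  Set.range (fun s : C × S => ⟨⊤, [s], ⊤⟩) ∪
  Set.range (fun a => ⟨⊤, [], φ.inst L (fun _ => cf.init) a⟩) ∪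
  (fun x : (C × S) × (S → Loc) × (S → Loc) × (Fin k → S) =>
    ⟨φ.insts L x.2.1 A, [x.1], φ.inst L x.2.2.1 x.2.2.2⟩) ''
      {x | LocStep cf P.code x.1 x.2.1 x.2.2.1} ∪
  (fun l => ⟨φ.insts L l A, [], ⊥⟩) '' {l | ∃ v, l v = cf.err}

theorem finite_invariantTriples [Finite C] [Finite Loc] [Finite S] (cf : ControlFlow C Loc)
    (P : Program LN D C S) (φ : Ashcroft LN LD Loc k) (L : List Loc) (A : List (Fin k → S)) :
    (invariantTriples cf P φ L A).Finite :=
  (((Set.finite_range _).union (Set.finite_range _)).union ((Set.toFinite _).image _)).union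
    ((Set.toFinite _).image _)

theorem totalRun_singleton {sem : C → (v : S) → Set ((nbhd LN v → D) × (nbhd LN v → D))}
    {s : C × S} {μ μ' : S → D} :
    TotalRun sem [s] μ μ' ↔ GlobalStep sem ⊤ s (fun x => μ x) (fun x => μ' x) := by
  rw [totalRun_cons]
  constructor
  · rintro ⟨ν, h₁, h₂⟩
    rw [← totalRun_nil.1 h₂]
    exact h₁
  · exact fun h => ⟨μ', h, totalRun_nil.2 rfl⟩

/-- As `A` lists every tuple, the precondition `φ.insts L l A` is the whole invariant at locations
`l`; each kind of triple is then one clause of invariance, or trivial. -/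
theorem valid_invariantTriples [LD.Structure D] [Nonempty D] {cf : ControlFlow C Loc} {P : Program LN D C S}
    {φ : Ashcroft LN LD Loc k} (hφ : IsAshcroftInvariant cf P φ) {L : List Loc}
    (hL : ∀ c, c ∈ L) {A : List (Fin k → S)} (hA : ∀ a, a ∈ A) {t : HoareTriple LD C S}
    (ht : t ∈ invariantTriples cf P φ L A) : t.Valid P.sem := by
  rw [HoareTriple.valid_iff]
  intro μ μ' hr hp
  rcases ht with ((⟨s, rfl⟩ | ⟨a, rfl⟩) | ⟨⟨s, l, l', a⟩, hs, rfl⟩) | ⟨l, ⟨v, hv⟩, rfl⟩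
  · exact BoundedFormula.realize_top.2 trivial
  · exact (Ashcroft.realize_inst hL _ _ _ _).2 (hφ.initialization (_, μ') (fun _ => rfl) a)
  · refine (Ashcroft.realize_inst hL _ _ _ _).2 (hφ.continuation (l, μ) (l', μ')
      (Ashcroft.holds_of_realize_insts hL hA hp) ⟨s, hs, totalRun_singleton.1 hr⟩ a)
  · exact (hφ.safety (l, μ) (Ashcroft.holds_of_realize_insts hL hA hp) v hv).elim

end Generators

/-! ### Derivability of the error runs. -/

section Completeness

variable {LN : FirstOrder.Language.{u₁, v₁}} {LD : FirstOrder.Language.{u₂, v₂}} {D : Type w₃}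
  {C : Type w₄} {Loc : Type w₅} {I : Type w₁}
  {T : I → Type w₂} [∀ i, LN.Structure (T i)] {U : Type w₆} [LN.Structure U] {k : ℕ}
  {cf : ControlFlow C Loc} {P : ∀ i, Program LN D C (T i)} {e : ∀ i, T i ↪[LN] U}
  {φ : Ashcroft LN LD Loc k} {J : Set I} {L : List Loc}
  {H : Set (HoareTriple LD C U)}

/-- A node and a `k`-tuple of nodes lie in a common basis topology. -/
theorem IsTopologyBasis.exists_embedding (hJ : IsTopologyBasis LN T (k + 1) J) {i : I} (v : T i)
    (a : Fin k → T i) :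
    ∃ j ∈ J, ∃ (f : T j ↪[LN] T i) (v' : T j) (a' : Fin k → T j), f v' = v ∧ f ∘ a' = a := by
  obtain ⟨j, hj, f, hf⟩ := hJ i (Fin.cons v a)
  choose b hb using hf
  exact ⟨j, hj, f, b 0, fun m => b m.succ, by simpa using hb 0,
    funext fun m => by simpa using hb m.succ⟩

/-- In a proof space with the invariant triples of a basis, the instances of the invariant at any
node tuples can be derived along any run of a member. -/
theorem insts_mem (A : ∀ j, List (Fin k → T j)) (hP : IsParameterized P) (hJ : IsTopologyBasis LN T (k + 1) J)
    (hJT : ∀ j ∈ J, Finite (T j)) (hH : IsProofSpace LN H) (hnil : ⟨⊤, [], ⊤⟩ ∈ H)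
    (hinv : ∀ j ∈ J, ∀ t ∈ invariantTriples cf (P j) φ L (A j), t.map (e j) ∈ H) {i : I}
    (v₀ : T i) (ρ : List (C × T i)) (l : T i → Loc)
    (hρ : LocRun cf (P i).code ρ (fun _ => cf.init) l) (X : List (Fin k → T i)) :
    ⟨⊤, ρ.map (Prod.map id (e i)), (φ.insts L l X).relabel (e i)⟩ ∈ H := by
  -- Both `e j` and `e i ∘ f` embed the finite topology `T j` into `U`, so the symmetry rule
  -- applies.
  have hinv' : ∀ j ∈ J, ∀ f : T j ↪[LN] T i, ∀ t ∈ invariantTriples cf (P j) φ L (A j),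
      t.map (e i ∘ f) ∈ H := by
    intro j hj f t ht
    have := hJT j hj
    exact hH.map_mem (e j) ((e i).comp f) (hinv j hj t ht)
  have hconj : ∀ (ρ' : List (C × U)), ⟨⊤, ρ', ⊤⟩ ∈ H → ∀ (l : T i → Loc) X,
      (∀ a ∈ X, ⟨⊤, ρ', (φ.inst L l a).relabel (e i)⟩ ∈ H) →
        ⟨⊤, ρ', (φ.insts L l X).relabel (e i)⟩ ∈ H := by
    intro ρ' htop l X hX
    rw [relabel_eq_mapFree, Ashcroft.insts, mapFree_conj, List.map_map]
    refine hH.conj_mem hnil htop _ fun ψ hψ => ?_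
    obtain ⟨a, ha, rfl⟩ := List.mem_map.1 hψ
    rw [Function.comp_apply, ← relabel_eq_mapFree]
    exact hX a ha
  induction ρ using List.reverseRecOn generalizing l X with
  | nil =>
    rw [← show (fun _ => cf.init) = l from hρ]
    refine hconj [] hnil _ X fun a _ => ?_
    -- No command is active yet; `v₀` only fills the spare place of the `k + 1` nodes.
    obtain ⟨j, hj, f, v, a, -, rfl⟩ := hJ.exists_embedding v₀ a
    have h := hinv' j hj f _ (.inl (.inl (.inr ⟨a, rfl⟩)))
    rw [← Ashcroft.relabel_inst f, relabel_relabel]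
    exact h
  | append_singleton ρ s ih =>
    obtain ⟨l₁, h₁, h₂⟩ := locRun_append_singleton hρ
    rw [List.map_append]
    refine hconj _ ?_ l X fun a _ => ?_
    · obtain ⟨j, hj, f, v, a, hv, -⟩ := hJ.exists_embedding s.2 fun _ => v₀
      have h := hinv' j hj f _ (.inl (.inl (.inl ⟨(s.1, v), rfl⟩)))
      -- With no tuples the conjunction of instances is `⊤`, so the induction hypothesis also yields
      -- the trivial triple.
      refine hH.sequencing ⊤ ⊤ ⊤ ⊤ _ _ (ih l₁ h₁ []) ?_ subset_rfl
      obtain ⟨c, _⟩ := s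
      subst hv
      exact h
    · obtain ⟨j, hj, f, v, a, hv, rfl⟩ := hJ.exists_embedding s.2 a
      obtain ⟨c, _⟩ := s
      subst hv
      have h := hinv' j hj f _ (.inl (.inr ⟨((c, v), l₁ ∘ f, l ∘ f, a),
        locStep_comp_embedding hP f h₂, rfl⟩))
      simp only [HoareTriple.map] at h
      -- Factoring the renaming through `T i` turns the precondition into the instances at the
      -- tuples `f ∘ b` with locations `l₁`: literally what the induction hypothesis gives for the
      -- list `(A j).map (f ∘ ·)`.
      rw [← relabel_relabel, ← relabel_relabel, Ashcroft.relabel_insts,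
        Ashcroft.relabel_inst] at h
      exact hH.sequencing _ _ _ _ _ _ (ih l₁ h₁ _) h subset_rfl

theorem errorRuns_subset_language (A : ∀ j, List (Fin k → T j)) (hP : IsParameterized P)
    (hJ : IsTopologyBasis LN T (k + 1) J) (hJT : ∀ j ∈ J, Finite (T j)) (hH : IsProofSpace LN H)
    (hnil : ⟨⊤, [], ⊤⟩ ∈ H)
    (hinv : ∀ j ∈ J, ∀ t ∈ invariantTriples cf (P j) φ L (A j), t.map (e j) ∈ H) {i : I}
    {ρ : List (C × T i)} (hρ : ρ ∈ errorRuns cf (P i).code) :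
    ρ.map (Prod.map id (e i)) ∈ language H := by
  obtain ⟨l, hl, v, hv⟩ := hρ
  -- Only the error node matters here; the `k`-tuple is a filler.
  obtain ⟨j, hj, f, v', -, rfl, -⟩ := hJ.exists_embedding v fun _ => v
  have := hJT j hj
  have h : HoareTriple.map (e i ∘ f) ⟨φ.insts L (l ∘ f) (A j), [], ⊥⟩ ∈ H :=
    hH.map_mem (e j) ((e i).comp f) (hinv j hj _ (.inr ⟨l ∘ f, ⟨v', hv⟩, rfl⟩))
  simp only [HoareTriple.map] at h
  rw [← relabel_relabel, Ashcroft.relabel_insts] at h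
  have h₁ := hH.sequencing _ _ _ _ _ _
    (insts_mem A hP hJ hJT hH hnil hinv (f v') ρ l hl ((A j).map (f ∘ ·))) h subset_rfl
  rw [List.map_nil, List.append_nil] at h₁
  exact h₁

end Completeness

end ParamProof

/-! ### The main theorem. -/

theorem theorem5p5 {LN : FirstOrder.Language.{_, _}} {LD : FirstOrder.Language.{_, _}} {D C Loc I U : Type*} {T : I → Type*}
    [LD.Structure D] [Nonempty D] [Finite C] [Finite Loc]
    [∀ i, LN.Structure (T i)] [LN.Structure U]
    (cf : ParamProof.ControlFlow C Loc)
    (P : ∀ i, ParamProof.Program LN D C (T i)) (hP : ParamProof.IsParameterized P)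
    (e : ∀ i, LN.Embedding (T i) U)
    (k : ℕ) (φ : ParamProof.Ashcroft LN LD Loc k)
    (hφ : ∀ i, ParamProof.IsAshcroftInvariant cf (P i) φ)
    (J : Set I) (hJ : ParamProof.IsTopologyBasis LN T (k + 1) J) (hJfin : J.Finite)
    (hJT : ∀ j ∈ J, Finite (T j)) :
    ∃ H : Set (ParamProof.HoareTriple LD C U),
      ParamProof.IsFinitelyGenerated LN H ∧ ParamProof.ProvesSafe cf P e H := by
  classical
  obtain ⟨L, hL⟩ : ∃ L : List Loc, ∀ c, c ∈ L := by
    have := Fintype.ofFinite Loc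
    exact ⟨Finset.univ.toList, by simp⟩
  have hA : ∀ j, ∃ A : List (Fin k → T j), j ∈ J → ∀ a, a ∈ A := by
    intro j
    by_cases hj : j ∈ J
    · have := hJT j hj
      have := Fintype.ofFinite (Fin k → T j)
      exact ⟨Finset.univ.toList, by simp⟩
    -- Outside the basis the list is arbitrary, as no generator uses it.
    · exact ⟨[], fun h => (hj h).elim⟩
  choose A hA using hA
  -- The additional triple `{⊤} ε {⊤}` is the one that `IsProofSpace.conj_mem` needs to restore the
  -- precondition `⊤`.
  let B : Set (ParamProof.HoareTriple LD C U) := {⟨⊤, [], ⊤⟩} ∪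
    ⋃ j ∈ J, ParamProof.HoareTriple.map (e j) '' ParamProof.invariantTriples cf (P j) φ L (A j)
  have hBfin : B.Finite := by
    refine (Set.finite_singleton _).union (hJfin.biUnion fun j hj => Set.Finite.image _ ?_)
    have := hJT j hj
    exact ParamProof.finite_invariantTriples _ _ _ _ _
  obtain ⟨H, hH⟩ := ParamProof.exists_isGeneratedBy LN B
  refine ⟨H, ⟨B, hBfin, hH⟩, ?_, fun i ρ hρ => ?_⟩
  -- By leastness of `H`, only the generators need to be checked for validity.
  · refine hH.2 ⟨ParamProof.isProofSpace_valid P, ?_⟩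
    rintro t (rfl | ht)
    · exact ParamProof.HoareTriple.valid_iff.2 fun μ μ' _ h =>
        FirstOrder.Language.BoundedFormula.realize_top.2 trivial
    · simp only [Set.mem_iUnion] at ht
      obtain ⟨j, hj, t, ht, rfl⟩ := ht
      exact (ParamProof.valid_invariantTriples (hφ j) hL (hA j hj) ht).map hP (e j)
  · refine ParamProof.errorRuns_subset_language (φ := φ) (L := L) A hP hJ hJT hH.1.1
      (hH.1.2 (.inl rfl)) ?_ hρ
    exact fun j hj t ht => hH.1.2 (.inr (Set.mem_biUnion hj ⟨t, ht, rfl⟩))
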